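/- A Borel set $B\subseteq\mathbb{R}$ is called \emph{measured} if there is a translation invariant Borel measure $\mu$ on $\mathbb{R}$ with $\mu(B)>0$ such that $B$ has $\sigma$-finite $\mu$-measure. Let $X$ be an infinite-dimensional real Banach space with a Schauder basis $(e_i)_{i\ge 1}$ satisfying $\|e_i\|=1$ for all $i$, and let $2\le n_1\le n_2\le\cdots$ be integers with $n_i\to\infty$. If $k_i\in\mathbb{Z}$ are such that the series $\sum_{i=1}^\infty \frac{k_i}{n_i}e_i$ converges in $X$, then $\sum_{i=1}^\infty \frac{k_i}{n_1\cdots n_i}$ converges in $\mathbb{R}$. Let $$A=\left\{\sum_{i=1}^\infty \frac{k_i}{n_1\cdots n_i}\ :\ k_i\in\mathbb{Z}\text{ and }\sum_{i=1}^\infty \frac{k_i}{n_i}e_i\text{ converges in }X\right\}.$$ Then $A$ is a Borel additive subgroup of $\mathbb{R}$, and $A$ is not a union of countably many measured sets. If moreover the basis is boundedly complete, that is, $\sum_i a_ie_i$ converges whenever $a_i\in\mathbb{R}$ and $\sup_N\left\|\sum_{i=1}^N a_ie_i\right\|<\infty$, then $A$ is $\sigma$-compact. For every $1\le p<\infty$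 the standard unit vectors form a normalized boundedly complete Schauder basis of $\ell_p$, so this applies to $\ell_p$. -/

import Mathlib

open Filter Topology MeasureTheory

/-- A set `B ⊆ ℝ` is measured if it is Borel and some translation invariant Borel measure on `ℝ`
assigns positive and `σ`-finite measure to `B`. The measure itself is not assumed to be
`σ`-finite or locally finite. -/
def IsMeasured (B : Set ℝ) : Prop :=
  MeasurableSet B ∧
    ∃ μ : Measure ℝ, μ.IsAddLeftInvariant ∧ 0 < μ B ∧ SigmaFinite (μ.restrict B)

/-- `A` is a union of countably many (possibly finitely many) measured sets. -/
def IsCountableUnionOfMeasured (A : Set ℝ) : Prop :=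
  ∃ F : Set (Set ℝ), F.Countable ∧ (∀ B ∈ F, IsMeasured B) ∧ ⋃₀ F = A

/-- The series `∑ u i` converges, i.e. its sequence of partial sums has a limit. -/
def SeriesConverges {E : Type*} [AddCommMonoid E] [TopologicalSpace E] (u : ℕ → E) : Prop :=
  ∃ s : E, Tendsto (fun N => ∑ i ∈ Finset.range N, u i) atTop (𝓝 s)

/-- A Schauder basis is boundedly complete if every series `∑ a i • e i` with bounded partial
sums converges. -/
def IsBoundedlyComplete {X : Type*} [NormedAddCommGroup X] [NormedSpace ℝ X]
    (e : SchauderBasis ℝ X) : Prop :=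
  ∀ a : ℕ → ℝ, (∃ M : ℝ, ∀ N : ℕ, ‖∑ i ∈ Finset.range N, a i • e i‖ ≤ M) →
    SeriesConverges (fun i => a i • e i)

/-- The terms `k i / (n 0 * n 1 * ⋯ * n i)` of a Cantor-type series. -/
noncomputable def cantorTerm (n : ℕ → ℕ) (k : ℕ → ℤ) (i : ℕ) : ℝ :=
  (k i : ℝ) / ∏ j ∈ Finset.range (i + 1), (n j : ℝ)

/-- The terms `(k i / n i) e i` of the associated series in the Banach space. -/
noncomputable def basisTerm {X : Type*} [NormedAddCommGroup X] [NormedSpace ℝ X]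
    (e : SchauderBasis ℝ X) (n : ℕ → ℕ) (k : ℕ → ℤ) (i : ℕ) : X :=
  ((k i : ℝ) / (n i : ℝ)) • e i

/-- The set of all sums `∑ k i / (n 0 * ⋯ * n i)`, where `k` runs over the integer sequences for
which `∑ (k i / n i) e i` converges in `X`. -/
def banachSubgroupSet {X : Type*} [NormedAddCommGroup X] [NormedSpace ℝ X]
    (e : SchauderBasis ℝ X) (n : ℕ → ℕ) : Set ℝ :=
  {x : ℝ | ∃ k : ℕ → ℤ, SeriesConverges (basisTerm e n k) ∧
    Tendsto (fun N => ∑ i ∈ Finset.range N, cantorTerm n k i) atTop (𝓝 x)}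

/-! The vectors whose `i`-th coordinate lies in `(1 / n i) ℤ` form a closed, hence Polish, subgroup
`Y` of `X`, and the Cantor series defines a continuous homomorphism `Φ : Y → ℝ` with range `A`.
Small digits cannot cancel, so `Φ` is injective on small balls. Thus `A` is a countable union of
injective continuous images of closed balls, which makes it Borel. As `n i → ∞`, small multiples of
the `e i` show that compact subsets of `Y` have empty interior.

Let `B ⊆ A` be measured by `μ`. A finite measure equivalent to `μ` on `B`, pulled back to small
balls, is tight, so `B` is `μ`-almost covered by `Φ '' S` with `S` σ-compact. Invariance makes every
translate of the remainder null, so its preimage is Haar null; the preimage of `Φ '' S` is σ-compact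
because `Φ` has countable kernel (`IsMeasured.exists_isHaarNull_isSigmaCompact`). If `A` were a
countable union of measured sets, `Y` would be covered by countably many Haar null Borel sets and
one σ-compact set. A common witness measure and Baire category exclude this
(`exists_notMem_isHaarNull_isSigmaCompact`).

For a boundedly complete basis, digit sequences with partial sums bounded by `M` form a compact set
on which the Cantor sum is continuous. -/

/-- A set is Haar null if all its translates are null for some Borel probability measure. -/
def IsHaarNull {Y : Type*} [AddCommGroup Y] [MeasurableSpace Y] (N : Set Y) : Prop :=
  ∃ ν : Measure Y, IsProbabilityMeasure ν ∧ ∀ g, ν ((fun y => y + g) ⁻¹' N) = 0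

/-! ### Product measures and tightness -/

/-- Resampling one coordinate does not change an infinite product measure. -/
theorem infinitePi_map_update {ι : Type*} [DecidableEq ι] {Ω : ι → Type*}
    [∀ i, MeasurableSpace (Ω i)] (P : ∀ i, Measure (Ω i)) [∀ i, IsProbabilityMeasure (P i)]
    (j : ι) :
    ((Measure.infinitePi P).prod (P j)).map (fun q => Function.update q.1 j q.2) =
      Measure.infinitePi P := by
  have hm : Measurable (fun q : (∀ i, Ω i) × Ω j => Function.update q.1 j q.2) := by
    refine measurable_pi_iff.2 fun i => ?_
    by_cases h : i = j
    · subst h; simpa using measurable_snd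
    · simpa [Function.update_of_ne h] using measurable_fst.eval
  refine Measure.eq_infinitePi P fun s t ht => ?_
  rw [Measure.map_apply hm (MeasurableSet.pi s.countable_toSet fun i _ => ht i)]
  by_cases hj : j ∈ s
  · have : (fun q : (∀ i, Ω i) × Ω j => Function.update q.1 j q.2) ⁻¹' (Set.pi s t) =
        Set.pi (s.erase j : Finset ι) t ×ˢ t j := by
      ext q
      simp only [Set.mem_preimage, Set.mem_pi, Set.mem_prod, Finset.mem_coe, Finset.mem_erase]
      constructor
      · intro h
        refine ⟨fun i hi => ?_, by simpa using h j hj⟩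
        simpa [Function.update_of_ne hi.1] using h i hi.2
      · rintro ⟨h2, h1⟩ i hi
        by_cases h : i = j
        · subst h; simpa using h1
        · simpa [Function.update_of_ne h] using h2 i ⟨h, hi⟩
    rw [this, Measure.prod_prod, Measure.infinitePi_pi _ (fun i _ => ht i),
      Finset.prod_erase_mul s (fun i => P i (t i)) hj]
  · have : (fun q : (∀ i, Ω i) × Ω j => Function.update q.1 j q.2) ⁻¹' (Set.pi s t) =
        Set.pi (s : Set ι) t ×ˢ Set.univ := by
      ext q
      simp only [Set.mem_preimage, Set.mem_pi, Set.mem_prod, Finset.mem_coe, Set.mem_univ,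
        and_true]
      refine forall₂_congr fun i hi => ?_
      rw [Function.update_of_ne (by rintro rfl; exact hj hi)]
    rw [this, Measure.prod_prod, Measure.infinitePi_pi _ (fun i _ => ht i)]
    simp

/-- An s-finite measure on a Polish space is carried by a `σ`-compact set. -/
theorem exists_compact_seq_measure_compl_eq_zero {Y : Type*} [TopologicalSpace Y] [PolishSpace Y]
    [MeasurableSpace Y] [BorelSpace Y] (ν : Measure Y) [SFinite ν] :
    ∃ Q : ℕ → Set Y, (∀ i, IsCompact (Q i)) ∧ ν (⋃ i, Q i)ᶜ = 0 := by
  have h : ∀ n : ℕ, ∃ K : Set Y, IsCompact (closure K) ∧ ν.toFinite Kᶜ < 1 / ((n : ENNReal) + 1) :=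
    fun n => exists_isCompact_closure_measure_compl_lt _ _ (by simp)
  choose K hK hlt using h
  refine ⟨fun i => closure (K i), hK, ?_⟩
  refine absolutelyContinuous_toFinite ν ?_
  have hle : ∀ n : ℕ, ν.toFinite (⋃ i, closure (K i))ᶜ ≤ ((n : ENNReal) + 1)⁻¹ := fun n =>
    (measure_mono (Set.compl_subset_compl.2
      (subset_closure.trans (Set.subset_iUnion (fun i => closure (K i)) n)))).trans
      ((hlt n).le.trans_eq (by simp))
  have hlim : Tendsto (fun n : ℕ => ((n : ENNReal) + 1)⁻¹) atTop (𝓝 0) := by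
    exact_mod_cast (tendsto_add_atTop_iff_nat 1).2 ENNReal.tendsto_inv_nat_nhds_zero
  exact le_antisymm (ge_of_tendsto' hlim hle) bot_le

/-! ### Haar null sets in Polish groups -/

section HaarNull

variable {Y : Type*} [NormedAddCommGroup Y] [SecondCountableTopology Y]
  [MeasurableSpace Y] [BorelSpace Y]

/-- The witness of a Haar null set can be chosen concentrated near `0`. -/
theorem IsHaarNull.exists_near_zero {N : Set Y} (hN : IsHaarNull N) {ε : ℝ} (hε : 0 < ε) :
    ∃ ν : Measure Y, IsProbabilityMeasure ν ∧ (∀ᵐ y ∂ν, ‖y‖ ≤ ε) ∧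
      ∀ g, ν ((fun y => y + g) ⁻¹' N) = 0 := by
  obtain ⟨ν, hν, h⟩ := hN
  obtain ⟨D, hDc, hD⟩ := TopologicalSpace.exists_countable_dense Y
  have hcov : (⋃ d ∈ D, Metric.closedBall d ε) = Set.univ := by
    refine Set.eq_univ_of_forall fun y => ?_
    obtain ⟨d, hd, hyd⟩ := hD.exists_dist_lt y hε
    exact Set.mem_biUnion hd (Metric.mem_closedBall.2 hyd.le)
  -- Countably many `ε`-balls cover the group, so one has positive mass; condition on it and move
  -- its centre to `0`.
  obtain ⟨d, -, hd⟩ : ∃ d ∈ D, ν (Metric.closedBall d ε) ≠ 0 := by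
    by_contra! hcon
    have := (measure_biUnion_null_iff hDc).2 hcon
    rw [hcov, measure_univ] at this
    exact one_ne_zero this
  have hp : IsProbabilityMeasure (ProbabilityTheory.cond ν (Metric.closedBall d ε)) :=
    ProbabilityTheory.cond_isProbabilityMeasure hd
  have hm : Measurable fun y : Y => y - d := by fun_prop
  refine ⟨(ProbabilityTheory.cond ν (Metric.closedBall d ε)).map (fun y => y - d),
    Measure.isProbabilityMeasure_map hm.aemeasurable, ?_, fun g => ?_⟩
  · rw [ae_map_iff hm.aemeasurable (measurableSet_le (by fun_prop) (by fun_prop))]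
    have := ProbabilityTheory.ae_cond_mem (μ := ν)
      (Metric.isClosed_closedBall (x := d) (ε := ε)).measurableSet
    filter_upwards [this] with y hy
    simpa [dist_eq_norm] using hy
  · have he : Measure.map (fun y => y - d) (ProbabilityTheory.cond ν (Metric.closedBall d ε)) =
      Measure.map (MeasurableEquiv.subRight d)
        (ProbabilityTheory.cond ν (Metric.closedBall d ε)) := rfl
    rw [he, MeasurableEquiv.map_apply]
    refine ProbabilityTheory.cond_absolutelyContinuous ?_
    convert h (g - d) using 2
    ext y
    change y - d + g ∈ N ↔ y + (g - d) ∈ N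
    rw [sub_add_eq_add_sub, add_sub_assoc]

/-- Countably many Haar null Borel sets have a common witness measure. -/
theorem exists_common_isHaarNull_witness [CompleteSpace Y] {N : ℕ → Set Y} (hm : ∀ n, MeasurableSet (N n))
    (hN : ∀ n, IsHaarNull (N n)) :
    ∃ ν : Measure Y, IsProbabilityMeasure ν ∧ ∀ n g, ν ((fun y => y + g) ⁻¹' N n) = 0 := by
  choose P hP hsmall hnull using fun n : ℕ =>
    (hN n).exists_near_zero (ε := (1 / 2) ^ n) (by positivity)
  have hF : Measurable fun z : ℕ → Y => ∑' i, z i := by fun_prop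
  refine ⟨(Measure.infinitePi P).map fun z => ∑' i, z i,
    Measure.isProbabilityMeasure_map hF.aemeasurable, fun n g => ?_⟩
  have hS : MeasurableSet ((fun y => y + g) ⁻¹' N n) := (measurable_add_const g) (hm n)
  have hup : Measurable (fun q : (ℕ → Y) × Y => Function.update q.1 n q.2) := by
    refine measurable_pi_iff.2 fun i => ?_
    by_cases h : i = n
    · subst h; simpa using measurable_snd
    · simpa [Function.update_of_ne h] using measurable_fst.eval
  have hsum : ∀ᵐ z ∂Measure.infinitePi P, Summable z := by
    have : ∀ᵐ z ∂Measure.infinitePi P, ∀ i, ‖z i‖ ≤ (1 / 2) ^ i := by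
      refine ae_all_iff.2 fun i => ?_
      exact (measurePreserving_eval_infinitePi P i).quasiMeasurePreserving.ae (hsmall i)
    filter_upwards [this] with z hz
    exact Summable.of_norm_bounded (summable_geometric_of_lt_one (by norm_num) (by norm_num)) hz
  -- The witness is the law of a random sum with independent terms. With all terms but the `n`-th
  -- frozen, the sum is that term plus a constant, so Fubini reduces the claim to `P n`.
  rw [Measure.map_apply hF hS, ← infinitePi_map_update P n, Measure.map_apply hup (hF hS),
    Measure.measure_prod_null (hup (hF hS))]
  filter_upwards [hsum] with z hz
  have hset : Prod.mk z ⁻¹' ((fun q : (ℕ → Y) × Y => Function.update q.1 n q.2) ⁻¹'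
      ((fun z => ∑' i, z i) ⁻¹' ((fun y => y + g) ⁻¹' N n))) =
      (fun y => y + (-z n + ∑' i, z i + g)) ⁻¹' N n := by
    ext a
    simp only [Set.mem_preimage]
    rw [(hz.hasSum.update n a).tsum_eq]
    congr! 1
    abel
  rw [hset]
  exact hnull n _

/-- A Polish group in which compact sets have empty interior is not covered by a `σ`-compact set
and countably many Haar null Borel sets. -/
theorem exists_notMem_isHaarNull_isSigmaCompact [CompleteSpace Y]
    (hY : ∀ Q : Set Y, IsCompact Q → interior Q = ∅) {N : ℕ → Set Y}
    (hm : ∀ n, MeasurableSet (N n)) (hN : ∀ n, IsHaarNull (N n)) {S : Set Y}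
    (hS : IsSigmaCompact S) : ∃ y, (∀ n, y ∉ N n) ∧ y ∉ S := by
  obtain ⟨Q, hQ, rfl⟩ := hS
  obtain ⟨ν, hν, h⟩ := exists_common_isHaarNull_witness hm hN
  obtain ⟨C, hC, hC0⟩ := exists_compact_seq_measure_compl_eq_zero ν
  -- The differences `Q i - C j` are compact, hence nowhere dense; by Baire some `g` avoids them
  -- all, and translating by `g` moves the carrier of `ν` off the σ-compact set.
  obtain ⟨g, hg⟩ : ∃ g, ∀ p : ℕ × ℕ, g ∉ (fun q : Y × Y => q.1 - q.2) '' (Q p.1 ×ˢ C p.2) := by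
    by_contra! hcon
    have hcpt : ∀ p : ℕ × ℕ, IsCompact ((fun q : Y × Y => q.1 - q.2) '' (Q p.1 ×ˢ C p.2)) :=
      fun p => ((hQ _).prod (hC _)).image (by fun_prop)
    obtain ⟨p, hp⟩ := nonempty_interior_of_iUnion_of_closed (fun p => (hcpt p).isClosed)
      (Set.eq_univ_of_forall fun g => Set.mem_iUnion.2 (hcon g))
    rw [hY _ (hcpt p)] at hp
    exact Set.not_nonempty_empty hp
  have hae : ∀ᵐ y ∂ν, y ∈ (⋃ i, C i) ∧ ∀ n, y + g ∉ N n := by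
    rw [eventually_and, ae_all_iff]
    refine ⟨?_, fun n => ?_⟩
    · exact hC0
    · have := h n g
      rw [ae_iff]
      simpa only [not_not] using! this
  obtain ⟨y, hy, hyN⟩ := hae.exists
  refine ⟨y + g, hyN, fun hmem => ?_⟩
  obtain ⟨n, hn⟩ := Set.mem_iUnion.1 hmem
  obtain ⟨i, hi⟩ := Set.mem_iUnion.1 hy
  exact hg (n, i) ⟨(y + g, y), ⟨hn, hi⟩, by simp⟩

end HaarNull

/-! ### Measured sets in the range of a locally injective homomorphism -/

section Measured

variable {Y : Type*} [NormedAddCommGroup Y]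

/-- A homomorphism with trivial kernel in a closed ball is injective on balls of half the
radius. -/
theorem AddMonoidHom.injOn_closedBall {G : Type*} [AddGroup G] {Φ : Y →+ G} {δ : ℝ}
    (hΦ : ∀ y, ‖y‖ ≤ δ → Φ y = 0 → y = 0) (d : Y) :
    Set.InjOn Φ (Metric.closedBall d (δ / 2)) := by
  intro x hx y hy hxy
  rw [← sub_eq_zero]
  refine hΦ _ ?_ (by rw [map_sub, hxy, sub_self])
  rw [← dist_eq_norm]
  have := dist_triangle_right x y d
  rw [Metric.mem_closedBall] at hx hy
  linarith

variable [SecondCountableTopology Y]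

theorem iUnion_closedBall_denseSeq {r : ℝ} (hr : 0 < r) :
    ⋃ m, Metric.closedBall (TopologicalSpace.denseSeq Y m) r = Set.univ := by
  refine Set.eq_univ_of_forall fun y => ?_
  obtain ⟨m, hm⟩ := (TopologicalSpace.denseRange_denseSeq Y).exists_dist_lt y hr
  exact Set.mem_iUnion.2 ⟨m, Metric.mem_closedBall.2 hm.le⟩

/-- The preimage of a `σ`-compact image under a locally injective homomorphism is `σ`-compact. -/
theorem IsSigmaCompact.preimage_image_of_locally_injective {G : Type*} [AddGroup G] {Φ : Y →+ G}
    {δ : ℝ} (hδ : 0 < δ) (hΦ : ∀ y, ‖y‖ ≤ δ → Φ y = 0 → y = 0) {S : Set Y}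
    (hS : IsSigmaCompact S) : IsSigmaCompact (Φ ⁻¹' (Φ '' S)) := by
  -- Each small ball contains at most one point of the kernel, and countably many such balls cover.
  have hker : Countable Φ.ker := by
    change (Φ.ker : Set Y).Countable
    have : (Φ.ker : Set Y) = ⋃ m, (Φ.ker : Set Y) ∩
        Metric.closedBall (TopologicalSpace.denseSeq Y m) (δ / 2) := by
      rw [← Set.inter_iUnion, iUnion_closedBall_denseSeq (half_pos hδ), Set.inter_univ]
    rw [this]
    refine Set.countable_iUnion fun m => Set.Subsingleton.countable ?_
    rintro x ⟨hx, hx'⟩ y ⟨hy, hy'⟩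
    refine AddMonoidHom.injOn_closedBall hΦ _ hx' hy' ?_
    rw [(AddMonoidHom.mem_ker).1 hx, (AddMonoidHom.mem_ker).1 hy]
  have : Φ ⁻¹' (Φ '' S) = ⋃ k : Φ.ker, (fun y => y + (k : Y)) '' S := by
    ext y
    simp only [Set.mem_preimage, Set.mem_image, Set.mem_iUnion]
    constructor
    · rintro ⟨x, hx, hxy⟩
      exact ⟨⟨-x + y, by rw [AddMonoidHom.mem_ker, map_add, map_neg, hxy, neg_add_cancel]⟩,
        x, hx, by simp⟩
    · rintro ⟨k, x, hx, rfl⟩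
      exact ⟨x, hx, by rw [map_add, (AddMonoidHom.mem_ker).1 k.2, add_zero]⟩
  rw [this]
  exact isSigmaCompact_iUnion _ fun k => hS.image (by fun_prop)

variable [CompleteSpace Y] [MeasurableSpace Y] [BorelSpace Y]

/-- A measured subset of the range of a continuous locally injective homomorphism pulls back to
the union of a Haar null Borel set and a `σ`-compact set. -/
theorem IsMeasured.exists_isHaarNull_isSigmaCompact {Φ : Y →+ ℝ} (hc : Continuous Φ) {δ : ℝ}
    (hδ : 0 < δ) (hΦ : ∀ y, ‖y‖ ≤ δ → Φ y = 0 → y = 0) {B : Set ℝ} (hB : IsMeasured B)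
    (hBΦ : B ⊆ Set.range Φ) :
    ∃ N S : Set Y, MeasurableSet N ∧ IsHaarNull N ∧ IsSigmaCompact S ∧ Φ ⁻¹' B ⊆ N ∪ S := by
  obtain ⟨hBm, μ, hinv, hpos, hfin⟩ := hB
  set ρ := (μ.restrict B).toFinite with hρ
  set D : ℕ → Set Y := fun m => Metric.closedBall (TopologicalSpace.denseSeq Y m) (δ / 2) with hD
  have hDu : ⋃ m, D m = Set.univ := iUnion_closedBall_denseSeq (half_pos hδ)
  have hP : ∀ m, PolishSpace (D m) := fun m => Metric.isClosed_closedBall.polishSpace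
  set j : ∀ m, D m → ℝ := fun m y => Φ y with hj
  have hje : ∀ m, MeasurableEmbedding (j m) := fun m =>
    (hc.comp continuous_subtype_val).measurableEmbedding
      (Set.injOn_iff_injective.1 (AddMonoidHom.injOn_closedBall hΦ _))
  have hfinm : ∀ m, IsFiniteMeasure (ρ.comap (j m)) := fun m =>
    ⟨by rw [(hje m).comap_apply]; exact measure_lt_top _ _⟩
  choose Q hQc hQ0 using fun m => exists_compact_seq_measure_compl_eq_zero (ρ.comap (j m))
  have hcov : B ⊆ ⋃ m, Set.range (j m) := by
    intro b hb
    obtain ⟨y, rfl⟩ := hBΦ hb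
    obtain ⟨m, hm⟩ := Set.mem_iUnion.1 (hDu.ge (Set.mem_univ y))
    exact Set.mem_iUnion.2 ⟨m, ⟨y, hm⟩, rfl⟩
  set S : Set Y := ⋃ m, ⋃ i, Subtype.val '' Q m i with hS
  have hSc : IsSigmaCompact S := isSigmaCompact_iUnion _ fun m => isSigmaCompact_iUnion _
    fun i => ((hQc m i).image continuous_subtype_val).isSigmaCompact
  have hΦSm : MeasurableSet (Φ '' S) := by
    obtain ⟨K, hK, hKS⟩ := hSc.image hc
    rw [← hKS]
    exact MeasurableSet.iUnion fun i => (hK i).measurableSet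
  have hNm : MeasurableSet (B \ Φ '' S) := hBm.diff hΦSm
  have hρN : ρ (B \ Φ '' S) = 0 := by
    refine measure_mono_null (t := ⋃ m, j m '' (⋃ i, Q m i)ᶜ) ?_ (measure_iUnion_null fun m => ?_)
    · rintro b ⟨hb, hbS⟩
      obtain ⟨m, y, rfl⟩ := Set.mem_iUnion.1 (hcov hb)
      refine Set.mem_iUnion.2 ⟨m, y, fun hy => hbS ?_, rfl⟩
      obtain ⟨i, hi⟩ := Set.mem_iUnion.1 hy
      exact ⟨y, Set.mem_iUnion₂.2 ⟨m, i, y, hi, rfl⟩, rfl⟩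
    · rw [← (hje m).comap_apply]; exact hQ0 m
  have hμN : μ (B \ Φ '' S) = 0 := by
    have := absolutelyContinuous_toFinite (μ.restrict B) hρN
    rwa [Measure.restrict_apply hNm, Set.inter_eq_left.2 Set.sdiff_subset] at this
  -- Here invariance of `μ` enters: `ρ` need not be invariant, but it is absolutely continuous with
  -- respect to `μ`.
  have htrans : ∀ t : ℝ, ρ ((fun x => t + x) ⁻¹' (B \ Φ '' S)) = 0 := fun t => by
    refine toFinite_absolutelyContinuous _ (Measure.restrict_le_self.absolutelyContinuous ?_)
    rw [measure_preimage_add, hμN]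
  -- Since `μ B > 0`, some ball carries mass; the normalized pullback to that ball is the Haar null
  -- witness.
  obtain ⟨m, hm⟩ : ∃ m, ρ.comap (j m) ≠ 0 := by
    by_contra! hcon
    have h0 : ρ B = 0 := measure_mono_null hcov (measure_iUnion_null fun m => by
      rw [← Set.image_univ, ← (hje m).comap_apply, hcon m]; rfl)
    have := absolutelyContinuous_toFinite (μ.restrict B) h0
    rw [Measure.restrict_apply_self] at this
    exact hpos.ne' this
  have hprob : IsProbabilityMeasure (ProbabilityTheory.cond (ρ.comap (j m)) Set.univ) :=
    ProbabilityTheory.cond_isProbabilityMeasure (by simpa using hm)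
  refine ⟨Φ ⁻¹' (B \ Φ '' S), Φ ⁻¹' (Φ '' S), hc.measurable hNm,
    ⟨(ProbabilityTheory.cond (ρ.comap (j m)) Set.univ).map Subtype.val,
      Measure.isProbabilityMeasure_map measurable_subtype_coe.aemeasurable, fun g => ?_⟩,
    hSc.preimage_image_of_locally_injective hδ hΦ, ?_⟩
  · rw [Measure.map_apply measurable_subtype_coe
      ((measurable_add_const g) (hc.measurable hNm))]
    refine ProbabilityTheory.cond_absolutelyContinuous ?_
    rw [(hje m).comap_apply]
    refine measure_mono_null ?_ (htrans (Φ g))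
    rintro _ ⟨y, hy, rfl⟩
    simpa [hj, add_comm] using hy
  · intro y hy
    by_cases h : Φ y ∈ Φ '' S
    · exact Or.inr h
    · exact Or.inl ⟨hy, h⟩

/-- The range of a continuous locally injective homomorphism from a Polish group whose compact
subsets have empty interior is not a countable union of measured sets. -/
theorem not_isCountableUnionOfMeasured_range
    (hY : ∀ Q : Set Y, IsCompact Q → interior Q = ∅) {Φ : Y →+ ℝ} (hc : Continuous Φ) {δ : ℝ}
    (hδ : 0 < δ) (hΦ : ∀ y, ‖y‖ ≤ δ → Φ y = 0 → y = 0) :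
    ¬ IsCountableUnionOfMeasured (Set.range Φ) := by
  rintro ⟨F, hFc, hF, hFu⟩
  have hne : F.Nonempty := by
    have : Φ 0 ∈ ⋃₀ F := hFu ▸ Set.mem_range_self 0
    obtain ⟨B, hB, -⟩ := this
    exact ⟨B, hB⟩
  obtain ⟨f, rfl⟩ := hFc.exists_eq_range hne
  choose N S hNm hN hS hsub using fun n =>
    (hF (f n) (Set.mem_range_self n)).exists_isHaarNull_isSigmaCompact hc hδ hΦ
      (hFu ▸ Set.subset_sUnion_of_mem (Set.mem_range_self n))
  obtain ⟨y, hyN, hyS⟩ := exists_notMem_isHaarNull_isSigmaCompact hY hNm hN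
    (isSigmaCompact_iUnion S hS)
  obtain ⟨_, ⟨n, rfl⟩, hn⟩ : Φ y ∈ ⋃₀ Set.range f := hFu ▸ Set.mem_range_self y
  rcases hsub n hn with h | h
  · exact hyN n h
  · exact hyS (Set.mem_iUnion.2 ⟨n, h⟩)

/-- The range of a continuous locally injective homomorphism from a Polish group is Borel. -/
theorem measurableSet_range_of_locally_injective {Φ : Y →+ ℝ} (hc : Continuous Φ) {δ : ℝ}
    (hδ : 0 < δ) (hΦ : ∀ y, ‖y‖ ≤ δ → Φ y = 0 → y = 0) : MeasurableSet (Set.range Φ) := by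
  rw [← Set.image_univ, ← iUnion_closedBall_denseSeq (half_pos hδ), Set.image_iUnion]
  exact MeasurableSet.iUnion fun m =>
    Metric.isClosed_closedBall.measurableSet.image_of_continuousOn_injOn hc.continuousOn (AddMonoidHom.injOn_closedBall hΦ _)

end Measured

/-! ### Estimates for Cantor series -/

section CantorSeries

variable {n : ℕ → ℕ}

theorem prod_range_cast_pos (hn : ∀ i, 2 ≤ n i) (i : ℕ) : 0 < ∏ j ∈ Finset.range i, (n j : ℝ) :=
  Finset.prod_pos fun j _ => by have := hn j; positivity

theorem prod_range_mul_two_pow_le (hn : ∀ i, 2 ≤ n i) (i j : ℕ) :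
    (∏ l ∈ Finset.range i, (n l : ℝ)) * 2 ^ j ≤ ∏ l ∈ Finset.range (i + j), (n l : ℝ) := by
  induction j with
  | zero => simp
  | succ j ih =>
    rw [← add_assoc, Finset.prod_range_succ, pow_succ, ← mul_assoc]
    have := prod_range_cast_pos hn (i + j)
    have h2 : (2 : ℝ) ≤ n (i + j) := by exact_mod_cast hn _
    gcongr

theorem abs_div_prod_range_le (hn : ∀ i, 2 ≤ n i) {a : ℕ → ℝ} {M : ℝ} (ha : ∀ i, |a i| ≤ M)
    (i j : ℕ) : |a (i + j) / ∏ l ∈ Finset.range (i + j), (n l : ℝ)| ≤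
      M / (∏ l ∈ Finset.range i, (n l : ℝ)) * (1 / 2) ^ j := by
  have h := prod_range_cast_pos hn i
  have hM : 0 ≤ M := (abs_nonneg _).trans (ha 0)
  rw [abs_div, abs_of_pos (prod_range_cast_pos hn (i + j)), one_div, inv_pow, ← div_eq_mul_inv,
    div_div]
  exact div_le_div₀ hM (ha _) (by positivity) (prod_range_mul_two_pow_le hn i j)

theorem summable_div_prod_range (hn : ∀ i, 2 ≤ n i) {a : ℕ → ℝ} {M : ℝ} (ha : ∀ i, |a i| ≤ M) :
    Summable fun i => a i / ∏ l ∈ Finset.range i, (n l : ℝ) := by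
  refine Summable.of_norm_bounded (g := fun i => M * (1 / 2) ^ i)
    (summable_geometric_two.mul_left M) fun i => ?_
  rw [Real.norm_eq_abs]
  simpa only [zero_add, Finset.range_zero, Finset.prod_empty, div_one] using
    abs_div_prod_range_le hn ha 0 i

theorem cantorTerm_eq (n : ℕ → ℕ) (k : ℕ → ℤ) (i : ℕ) :
    cantorTerm n k i = (k i / n i : ℝ) / ∏ l ∈ Finset.range i, (n l : ℝ) := by
  rw [cantorTerm, Finset.prod_range_succ, div_div, mul_comm]

/-- A Cantor series with small digits vanishes only if all digits do. -/
theorem eq_zero_of_hasSum_div_prod_range (hn : ∀ i, 2 ≤ n i) {k : ℕ → ℤ}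
    (ha : ∀ i, |(k i / n i : ℝ)| ≤ 1 / 4)
    (h0 : HasSum (fun i => (k i / n i : ℝ) / ∏ l ∈ Finset.range i, (n l : ℝ)) 0) (i : ℕ) :
    k i = 0 := by
  induction i using Nat.strong_induction_on with
  | _ i ih =>
  have hpi := prod_range_cast_pos hn i
  have hni : (0 : ℝ) < n i := by have := hn i; positivity
  have htail := (hasSum_nat_add_iff' (i + 1)).2 h0
  have hhead : ∑ j ∈ Finset.range (i + 1), (k j / n j : ℝ) / ∏ l ∈ Finset.range j, (n l : ℝ) =
      (k i / n i : ℝ) / ∏ l ∈ Finset.range i, (n l : ℝ) := by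
    rw [Finset.sum_range_succ, Finset.sum_eq_zero, zero_add]
    intro j hj
    simp [ih j (Finset.mem_range.1 hj)]
  rw [hhead, zero_sub] at htail
  have hgeo := (hasSum_geometric_two).mul_left
    (1 / 4 / ∏ l ∈ Finset.range (i + 1), (n l : ℝ))
  have hle : ‖-((k i / n i : ℝ) / ∏ l ∈ Finset.range i, (n l : ℝ))‖ ≤
      1 / 4 / (∏ l ∈ Finset.range (i + 1), (n l : ℝ)) * 2 := by
    rw [← htail.tsum_eq]
    refine tsum_of_norm_bounded hgeo fun j => ?_
    rw [add_comm j (i + 1)]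
    exact abs_div_prod_range_le hn ha (i + 1) j
  rw [norm_neg, Finset.prod_range_succ, div_div, mul_comm (n i : ℝ), Real.norm_eq_abs, abs_div,
    abs_of_pos (mul_pos hpi hni), div_mul_eq_mul_div,
    div_le_div_iff_of_pos_right (mul_pos hpi hni)] at hle
  -- The tail after the first possibly nonzero term is at most `2 * (1 / 4)` over the product up to
  -- `n i`, whence `|k i| ≤ 1 / 2`.
  have : |(k i : ℝ)| < 1 := by linarith
  exact Int.abs_lt_one_iff.1 (by exact_mod_cast this)

end CantorSeries

/-! ### The lattice subgroup of a Schauder basis and its Cantor functional -/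

section Basis

variable {X : Type*} [NormedAddCommGroup X] [NormedSpace ℝ X] (e : SchauderBasis ℝ X)

namespace SchauderBasis

theorem coord_sum_range (a : ℕ → ℝ) {i N : ℕ} (h : i < N) :
    e.coord i (∑ j ∈ Finset.range N, a j • e j) = a i := by
  simp [e.ortho, Pi.single_apply, h]

theorem coord_eq_of_tendsto {a : ℕ → ℝ} {s : X}
    (h : Tendsto (fun N => ∑ i ∈ Finset.range N, a i • e i) atTop (𝓝 s)) (i : ℕ) :
    e.coord i s = a i := by
  refine tendsto_nhds_unique (((e.coord i).continuous.tendsto s).comp h) ?_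
  refine tendsto_const_nhds.congr' ?_
  filter_upwards [eventually_gt_atTop i] with N hN
  exact (coord_sum_range e a hN).symm

theorem seriesConverges_iff {a : ℕ → ℝ} :
    SeriesConverges (fun i => a i • e i) ↔ ∃ x, ∀ i, e.coord i x = a i := by
  constructor
  · rintro ⟨s, hs⟩
    exact ⟨s, e.coord_eq_of_tendsto hs⟩
  · rintro ⟨x, hx⟩
    refine ⟨x, ?_⟩
    simpa [hx] using e.tendsto_proj x

theorem eq_zero_of_coord_eq_zero {x : X} (h : ∀ i, e.coord i x = 0) : x = 0 := by
  refine tendsto_nhds_unique (e.tendsto_proj x) ?_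
  simp [h]

/-- A term of the series is the difference of two consecutive partial sums. -/
theorem abs_le_of_norm_sum_range_le (he : ∀ i, ‖e i‖ = 1) {a : ℕ → ℝ} {M : ℝ}
    (h : ∀ N, ‖∑ i ∈ Finset.range N, a i • e i‖ ≤ M) (i : ℕ) : |a i| ≤ 2 * M := by
  have h1 : a i • e i =
      ∑ j ∈ Finset.range (i + 1), a j • e j - ∑ j ∈ Finset.range i, a j • e j := by
    rw [Finset.sum_range_succ, add_sub_cancel_left]
  have h2 : ‖a i • e i‖ = |a i| := by rw [norm_smul, he, mul_one, Real.norm_eq_abs]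
  rw [← h2, h1, two_mul]
  exact (norm_sub_le _ _).trans (add_le_add (h _) (h _))

theorem exists_abs_coord_le [CompleteSpace X] (he : ∀ i, ‖e i‖ = 1) :
    ∃ C : ℝ, 0 < C ∧ ∀ i x, |e.coord i x| ≤ C * ‖x‖ := by
  obtain ⟨C, hC⟩ := e.exists_norm_proj_le
  refine ⟨2 * max C 1, by positivity, fun i x => ?_⟩
  rw [mul_assoc]
  refine e.abs_le_of_norm_sum_range_le he (a := fun i => e.coord i x) (fun N => ?_) i
  rw [← e.proj_apply]
  exact (e.proj N).le_of_opNorm_le ((hC N).trans (le_max_left _ _)) x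

theorem separableSpace (e : SchauderBasis ℝ X) : TopologicalSpace.SeparableSpace X := by
  rw [← TopologicalSpace.isSeparable_univ_iff]
  have hs : TopologicalSpace.IsSeparable (closure (Submodule.span ℝ (Set.range e) : Set X)) :=
    (Set.countable_range e).isSeparable.span.closure
  refine hs.mono fun x _ => ?_
  refine mem_closure_of_tendsto (e.tendsto_proj x) (Eventually.of_forall fun N => ?_)
  rw [e.proj_apply]
  exact Submodule.sum_mem _ fun i _ => Submodule.smul_mem _ _ (Submodule.subset_span ⟨i, rfl⟩)

/-- The closed subgroup of the vectors whose `i`-th coordinate is an integer multiple of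
`1 / n i`. -/
def latticeSubgroup (n : ℕ → ℕ) : AddSubgroup X where
  carrier := {x | ∀ i, ∃ k : ℤ, e.coord i x = k / n i}
  zero_mem' i := ⟨0, by simp⟩
  add_mem' {x y} hx hy i := by
    obtain ⟨k, hk⟩ := hx i
    obtain ⟨l, hl⟩ := hy i
    exact ⟨k + l, by rw [map_add, hk, hl]; push_cast; ring⟩
  neg_mem' {x} hx i := by
    obtain ⟨k, hk⟩ := hx i
    exact ⟨-k, by rw [map_neg, hk]; push_cast; ring⟩

theorem mem_latticeSubgroup {n : ℕ → ℕ} {x : X} :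
    x ∈ e.latticeSubgroup n ↔ ∀ i, ∃ k : ℤ, e.coord i x = k / n i := Iff.rfl

theorem isClosed_latticeSubgroup {n : ℕ → ℕ} (hn : ∀ i, 2 ≤ n i) :
    IsClosed (e.latticeSubgroup n : Set X) := by
  have : (e.latticeSubgroup n : Set X) =
      ⋂ i, (fun x => e.coord i x * n i) ⁻¹' (Set.range fun k : ℤ => (k : ℝ)) := by
    ext x
    simp only [SetLike.mem_coe, mem_latticeSubgroup, Set.mem_iInter, Set.mem_preimage,
      Set.mem_range]
    refine forall_congr' fun i => exists_congr fun k => ?_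
    have hni : (n i : ℝ) ≠ 0 := by have := hn i; positivity
    rw [eq_div_iff hni, eq_comm]
  rw [this]
  exact isClosed_iInter fun i => Int.isClosedEmbedding_coe_real.isClosed_range.preimage
    (by fun_prop)

/-- The functional summing the Cantor series with coefficients given by the coordinates. -/
noncomputable def cantorFunctional (n : ℕ → ℕ) : StrongDual ℝ X :=
  ∑' i, (∏ l ∈ Finset.range i, (n l : ℝ))⁻¹ • e.coord i

/-- The coordinate functionals of a normalized basis are uniformly bounded, so the series defining
the functional converges absolutely in the dual. -/
theorem hasSum_cantorFunctional [CompleteSpace X] (he : ∀ i, ‖e i‖ = 1) {n : ℕ → ℕ}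
    (hn : ∀ i, 2 ≤ n i) (x : X) :
    HasSum (fun i => e.coord i x / ∏ l ∈ Finset.range i, (n l : ℝ)) (e.cantorFunctional n x) := by
  obtain ⟨C, hC0, hC⟩ := e.exists_abs_coord_le he
  have hs : Summable fun i => (∏ l ∈ Finset.range i, (n l : ℝ))⁻¹ • e.coord i := by
    have hb : ∀ i, |‖e.coord i‖| ≤ C := fun i => by
      rw [abs_norm]
      exact ContinuousLinearMap.opNorm_le_bound _ hC0.le (hC i)
    refine Summable.of_norm ((summable_div_prod_range hn hb).congr fun i => ?_)
    rw [norm_smul, norm_inv, Real.norm_of_nonneg (prod_range_cast_pos hn i).le, div_eq_inv_mul]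
  have := (ContinuousLinearMap.apply ℝ ℝ x).hasSum hs.hasSum
  simpa [div_eq_inv_mul] using! this

/-- The restriction of the Cantor functional to the lattice subgroup. -/
noncomputable def cantorHom (n : ℕ → ℕ) : e.latticeSubgroup n →+ ℝ :=
  (e.cantorFunctional n : X →+ ℝ).comp (e.latticeSubgroup n).subtype

theorem cantorHom_apply (n : ℕ → ℕ) (y : e.latticeSubgroup n) :
    e.cantorHom n y = e.cantorFunctional n y := rfl

theorem continuous_cantorHom (n : ℕ → ℕ) : Continuous (e.cantorHom n) :=
  (e.cantorFunctional n).continuous.comp continuous_subtype_val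

theorem exists_forall_cantorHom_eq_zero [CompleteSpace X] (he : ∀ i, ‖e i‖ = 1) {n : ℕ → ℕ}
    (hn : ∀ i, 2 ≤ n i) :
    ∃ δ : ℝ, 0 < δ ∧ ∀ y : e.latticeSubgroup n, ‖y‖ ≤ δ → e.cantorHom n y = 0 → y = 0 := by
  obtain ⟨C, hC0, hC⟩ := e.exists_abs_coord_le he
  -- This radius keeps every coordinate within `1 / 4`, the range in which digits cannot cancel.
  refine ⟨1 / 4 / C, by positivity, fun y hy h0 => ?_⟩
  choose k hk using e.mem_latticeSubgroup.1 y.2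
  have hsum := e.hasSum_cantorFunctional he hn y
  rw [← cantorHom_apply, h0] at hsum
  simp only [hk] at hsum
  have hk0 := eq_zero_of_hasSum_div_prod_range hn (fun i => ?_) hsum
  · refine Subtype.ext (e.eq_zero_of_coord_eq_zero fun i => ?_)
    rw [hk, hk0]
    simp
  · rw [← hk]
    refine (hC i y).trans ?_
    rw [le_div_iff₀' hC0] at hy
    exact hy

/-- If `n i → ∞` then the lattice subgroup is nowhere locally compact. -/
theorem interior_eq_empty_of_isCompact (he : ∀ i, ‖e i‖ = 1) {n : ℕ → ℕ} (hn : ∀ i, 2 ≤ n i)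
    (hlim : Tendsto n atTop atTop) {Q : Set (e.latticeSubgroup n)} (hQ : IsCompact Q) :
    interior Q = ∅ := by
  rw [Set.eq_empty_iff_forall_notMem]
  intro x hx
  obtain ⟨r, hr, hball⟩ := Metric.isOpen_iff.1 isOpen_interior x hx
  have hnpos : ∀ i, (0 : ℝ) < n i := fun i => by have := hn i; positivity
  -- Rounding `r / 2` down to a multiple of `1 / n i` puts `c i • e i` in the subgroup; once `n i ≥
  -- 4 / r` the rounding loses at most `r / 4`.
  set c : ℕ → ℝ := fun i => (⌊(n i : ℝ) * (r / 2)⌋ : ℤ) / n i with hc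
  have hc_le : ∀ i, c i ≤ r / 2 := fun i => by
    rw [hc]
    simp only
    rw [div_le_iff₀' (hnpos i)]
    exact Int.floor_le _
  have hc_nonneg : ∀ i, 0 ≤ c i := fun i =>
    div_nonneg (by exact_mod_cast Int.floor_nonneg.2 (mul_nonneg (hnpos i).le (half_pos hr).le))
      (hnpos i).le
  have hc_ge : ∀ᶠ i in atTop, r / 4 ≤ c i := by
    filter_upwards [(tendsto_natCast_atTop_atTop (R := ℝ)).comp hlim |>.eventually_ge_atTop (4 / r)]
      with i hi
    simp only [Function.comp_apply, div_le_iff₀ hr] at hi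
    rw [hc]
    simp only
    rw [le_div_iff₀' (hnpos i)]
    have := Int.lt_floor_add_one ((n i : ℝ) * (r / 2))
    linarith
  have hmem : ∀ i, c i • e i ∈ e.latticeSubgroup n := fun i j => by
    by_cases h : j = i
    · subst h
      exact ⟨⌊(n j : ℝ) * (r / 2)⌋, by simp [e.ortho, hc]⟩
    · exact ⟨0, by simp [e.ortho, h]⟩
  set y : ℕ → e.latticeSubgroup n := fun i => ⟨c i • e i, hmem i⟩ with hy
  have hynorm : ∀ i, ‖y i‖ = c i := fun i => by
    rw [hy, AddSubgroup.coe_norm, norm_smul, he, mul_one, Real.norm_of_nonneg (hc_nonneg i)]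
  have hyQ : ∀ i, x + y i ∈ Q := fun i => by
    refine interior_subset (hball ?_)
    rw [Metric.mem_ball, dist_eq_norm, add_sub_cancel_left, hynorm]
    linarith [hc_le i]
  obtain ⟨z, -, f, hf, hz⟩ := hQ.tendsto_subseq hyQ
  have hz' : Tendsto (fun i => y (f i)) atTop (𝓝 (z - x)) := by
    simpa using hz.sub_const x
  -- Each coordinate eventually vanishes along the subsequence, so the limit must be `0`, although
  -- the norms stay at least `r / 4`.
  have hzero : ((z - x : e.latticeSubgroup n) : X) = 0 := by
    refine e.eq_zero_of_coord_eq_zero fun m => ?_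
    refine tendsto_nhds_unique
      (((e.coord m).continuous.comp continuous_subtype_val).tendsto _ |>.comp hz') ?_
    refine tendsto_const_nhds.congr' ?_
    filter_upwards [hf.tendsto_atTop.eventually_gt_atTop m] with i hi
    simp [hy, e.ortho, hi.ne]
  have hnorm := hz'.norm
  rw [AddSubgroup.coe_norm (z - x), hzero, norm_zero] at hnorm
  have := ge_of_tendsto hnorm (hf.tendsto_atTop.eventually hc_ge |>.mono fun i hi => by
    rw [hynorm]; exact hi)
  linarith

end SchauderBasis

end Basis

/-! ### The set of sums as a range, and its σ-compactness -/

section Subgroup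

variable {X : Type*} [NormedAddCommGroup X] [NormedSpace ℝ X] (e : SchauderBasis ℝ X)

theorem seriesConverges_basisTerm_iff {n : ℕ → ℕ} {k : ℕ → ℤ} :
    SeriesConverges (basisTerm e n k) ↔ ∃ x, ∀ i, e.coord i x = k i / n i :=
  e.seriesConverges_iff

theorem SchauderBasis.hasSum_cantorTerm [CompleteSpace X] (he : ∀ i, ‖e i‖ = 1) {n : ℕ → ℕ}
    (hn : ∀ i, 2 ≤ n i) {k : ℕ → ℤ} {x : X} (hx : ∀ i, e.coord i x = k i / n i) :
    HasSum (cantorTerm n k) (e.cantorFunctional n x) := by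
  have := e.hasSum_cantorFunctional he hn x
  simp only [hx] at this
  simpa only [← cantorTerm_eq] using this

theorem banachSubgroupSet_eq_range [CompleteSpace X] (he : ∀ i, ‖e i‖ = 1) {n : ℕ → ℕ}
    (hn : ∀ i, 2 ≤ n i) : banachSubgroupSet e n = Set.range (e.cantorHom n) := by
  ext t
  constructor
  · rintro ⟨k, hk, ht⟩
    obtain ⟨x, hx⟩ := (seriesConverges_basisTerm_iff e).1 hk
    refine ⟨⟨x, fun i => ⟨k i, hx i⟩⟩, ?_⟩
    exact tendsto_nhds_unique (e.hasSum_cantorTerm he hn hx).tendsto_sum_nat ht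
  · rintro ⟨y, rfl⟩
    choose k hk using e.mem_latticeSubgroup.1 y.2
    exact ⟨k, (seriesConverges_basisTerm_iff e).2 ⟨y, hk⟩,
      (e.hasSum_cantorTerm he hn hk).tendsto_sum_nat⟩

/-- Integer sequences whose associated series has partial sums bounded by `M` form a compact
set. -/
theorem isCompact_setOf_norm_sum_basisTerm_le (he : ∀ i, ‖e i‖ = 1) {n : ℕ → ℕ}
    (hn : ∀ i, 2 ≤ n i) (M : ℝ) :
    IsCompact {k : ℕ → ℤ | ∀ N, ‖∑ i ∈ Finset.range N, basisTerm e n k i‖ ≤ M} := by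
  refine (isCompact_univ_pi fun i => (Set.finite_Icc (-⌈2 * M * n i⌉) ⌈2 * M * n i⌉).isCompact
    ).of_isClosed_subset ?_ fun k hk i _ => ?_
  · simp only [Set.ofPred_forall]
    refine isClosed_iInter fun N => isClosed_le (Continuous.norm (continuous_finsetSum _
      fun i _ => ?_)) continuous_const
    have : Continuous fun m : ℤ => ((m : ℝ) / n i) • e i := continuous_of_discreteTopology
    exact this.comp (continuous_apply i)
  · have h := e.abs_le_of_norm_sum_range_le he hk i
    have hni : (0 : ℝ) < n i := by have := hn i; positivity
    rw [abs_div, abs_of_pos hni, div_le_iff₀ hni] at h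
    have h' : |k i| ≤ ⌈2 * M * n i⌉ := by
      have := h.trans (Int.le_ceil _)
      exact_mod_cast this
    exact abs_le.1 h'

/-- Convergent series have bounded partial sums, and bounded completeness gives the converse; so the
set is the union over `M` of the images of the compact sets `Z M`. The sum is continuous there by
geometric domination. -/
theorem isSigmaCompact_banachSubgroupSet (he : ∀ i, ‖e i‖ = 1) {n : ℕ → ℕ}
    (hn : ∀ i, 2 ≤ n i) (hb : IsBoundedlyComplete e) : IsSigmaCompact (banachSubgroupSet e n) := by
  set Z : ℕ → Set (ℕ → ℤ) := fun M =>
    {k | ∀ N, ‖∑ i ∈ Finset.range N, basisTerm e n k i‖ ≤ M} with hZ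
  have hbound : ∀ M, ∀ k ∈ Z M, ∀ i, |(k i / n i : ℝ)| ≤ 2 * M := fun M k hk =>
    e.abs_le_of_norm_sum_range_le he hk
  refine ⟨fun M => (fun k => ∑' i, cantorTerm n k i) '' Z M, fun M => ?_, ?_⟩
  · refine (isCompact_setOf_norm_sum_basisTerm_le e he hn M).image_of_continuousOn ?_
    refine continuousOn_tsum (u := fun i => 2 * M * (1 / 2 : ℝ) ^ i) (fun i => ?_)
      (summable_geometric_two.mul_left _) fun i k hk => ?_
    · have : Continuous fun m : ℤ => (m : ℝ) / ∏ j ∈ Finset.range (i + 1), (n j : ℝ) :=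
        continuous_of_discreteTopology
      exact (this.comp (continuous_apply i)).continuousOn
    · rw [cantorTerm_eq, Real.norm_eq_abs]
      simpa only [zero_add, Finset.range_zero, Finset.prod_empty, div_one] using
        abs_div_prod_range_le hn (hbound M k hk) 0 i
  · ext t
    simp only [Set.mem_iUnion, Set.mem_image]
    constructor
    · rintro ⟨M, k, hk, rfl⟩
      refine ⟨k, hb _ ⟨M, hk⟩, Summable.tendsto_sum_tsum_nat ?_⟩
      simpa only [← cantorTerm_eq] using summable_div_prod_range hn (hbound M k hk)
    · rintro ⟨k, ⟨s, hs⟩, ht⟩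
      obtain ⟨R, hR⟩ := isBounded_iff_forall_norm_le.1 (Metric.isBounded_range_of_tendsto _ hs)
      obtain ⟨M, hM⟩ := exists_nat_ge R
      have hk : k ∈ Z M := fun N => (hR _ (Set.mem_range_self N)).trans hM
      refine ⟨M, k, hk, tendsto_nhds_unique (Summable.tendsto_sum_tsum_nat ?_) ht⟩
      simpa only [← cantorTerm_eq] using summable_div_prod_range hn (hbound M k hk)

end Subgroup

/-! ### The unit vector basis of `ℓᵖ` -/

section Lp

variable (p : ENNReal) [Fact (1 ≤ p)]

/-- The standard unit vectors as a Schauder basis of `ℓᵖ`, `p < ∞`. -/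
noncomputable def lpStandardBasis (hp : p ≠ ⊤) : SchauderBasis ℝ (lp (fun _ : ℕ => ℝ) p) where
  basis i := lp.single p i (1 : ℝ)
  coord i := lp.evalCLM ℝ (fun _ : ℕ => ℝ) p i
  ortho i j := by simp [lp.evalCLM, Pi.single_apply]
  expansion x := by
    have h := (lp.hasSum_single hp x).mono_left (SummationFilter.conditional ℕ).le_atTop
    refine h.congr fun s => Finset.sum_congr rfl fun i _ => ?_
    change lp.single p i (x i) = x i • lp.single (E := fun _ : ℕ => ℝ) p i 1
    rw [← lp.single_smul, smul_eq_mul, mul_one]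

/-- A bound `M` on the partial sums bounds `∑ |a i| ^ p` by `M ^ p`, so the coefficient sequence
itself lies in `ℓᵖ` and is the sum. -/
theorem isBoundedlyComplete_lpStandardBasis (hp : p ≠ ⊤) :
    IsBoundedlyComplete (lpStandardBasis p hp) := by
  rintro a ⟨M, hM⟩
  have hp0 : 0 < p.toReal :=
    ENNReal.toReal_pos (zero_lt_one.trans_le (Fact.out : 1 ≤ p)).ne' hp
  have hterm : ∀ i, a i • lpStandardBasis p hp i = lp.single p i (a i) := fun i => by
    change a i • lp.single (E := fun _ : ℕ => ℝ) p i 1 = _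
    rw [← lp.single_smul, smul_eq_mul, mul_one]
  simp only [hterm] at hM
  have hmem : Memℓp a p := by
    refine memℓp_gen (summable_of_sum_range_le (c := M ^ p.toReal) (fun i => by positivity)
      fun N => ?_)
    rw [← lp.norm_sum_single hp0 a]
    exact Real.rpow_le_rpow (norm_nonneg _) (hM N) hp0.le
  refine ⟨⟨a, hmem⟩, ?_⟩
  simp only [hterm]
  exact (lp.hasSum_single hp (⟨a, hmem⟩ : lp (fun _ : ℕ => ℝ) p)).tendsto_sum_nat

end Lp

theorem theorem3p6 :
    (∀ (X : Type*) [NormedAddCommGroup X] [NormedSpace ℝ X] [CompleteSpace X]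
      (e : SchauderBasis ℝ X) (_ : ∀ i, ‖e i‖ = 1)
      (n : ℕ → ℕ) (_ : 2 ≤ n 0) (_ : Monotone n) (_ : Tendsto n atTop atTop),
      (∀ k : ℕ → ℤ, SeriesConverges (basisTerm e n k) → SeriesConverges (cantorTerm n k)) ∧
      MeasurableSet (banachSubgroupSet e n) ∧
      (∃ H : AddSubgroup ℝ, (H : Set ℝ) = banachSubgroupSet e n) ∧
      ¬ IsCountableUnionOfMeasured (banachSubgroupSet e n) ∧
      (IsBoundedlyComplete e → IsSigmaCompact (banachSubgroupSet e n))) ∧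
    (∀ (p : ENNReal) [Fact (1 ≤ p)], p ≠ ⊤ →
      ∃ e : SchauderBasis ℝ (lp (fun _ : ℕ => ℝ) p),
        (∀ i, e i = lp.single p i (1 : ℝ)) ∧ (∀ i, ‖e i‖ = 1) ∧ IsBoundedlyComplete e) := by

  refine ⟨?_, fun p _ hp => ⟨lpStandardBasis p hp, fun i => rfl, fun i => ?_,
    isBoundedlyComplete_lpStandardBasis p hp⟩⟩
  · intro X _ _ _ e he n hn0 hmono hlim
    have hn : ∀ i, 2 ≤ n i := fun i => hn0.trans (hmono (Nat.zero_le i))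
    have := e.separableSpace
    have : SecondCountableTopology X := UniformSpace.secondCountable_of_separable X
    have : CompleteSpace (e.latticeSubgroup n) :=
      (e.isClosed_latticeSubgroup hn).completeSpace_coe
    borelize ↥(e.latticeSubgroup n)
    obtain ⟨δ, hδ, hinj⟩ := e.exists_forall_cantorHom_eq_zero he hn
    refine ⟨fun k hk => ?_, ?_, ⟨(e.cantorHom n).range, ?_⟩, ?_,
      isSigmaCompact_banachSubgroupSet e he hn⟩
    · obtain ⟨x, hx⟩ := (seriesConverges_basisTerm_iff e).1 hk
      exact ⟨_, (e.hasSum_cantorTerm he hn hx).tendsto_sum_nat⟩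
    · rw [banachSubgroupSet_eq_range e he hn]
      exact measurableSet_range_of_locally_injective (e.continuous_cantorHom n) hδ hinj
    · rw [banachSubgroupSet_eq_range e he hn, AddMonoidHom.coe_range]
    · rw [banachSubgroupSet_eq_range e he hn]
      exact not_isCountableUnionOfMeasured_range
        (fun Q hQ => e.interior_eq_empty_of_isCompact he hn hlim hQ)
        (e.continuous_cantorHom n) hδ hinj
  · change ‖lp.single (E := fun _ : ℕ => ℝ) p i 1‖ = 1
    rw [lp.norm_single (zero_lt_one.trans_le (Fact.out : 1 ≤ p)), norm_one]
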